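/- Let $[k]=\{1,\dots,k\}$. In a word $w=w_1w_2\cdots w_n$ of positive integers, a pair of positions $(i,j)$ with $1\le i<j\le n$ is called visible if $w_m<\min\{w_i,w_j\}$ for all $i<m<j$; let $\mathrm{vis}(w)$ be the number of visible pairs of $w$. Define, in the ring $\mathbb Z[q][[x]]$ of formal power series in $x$ over $\mathbb Z[q]$, $$F_k(x,q)=\sum_{n\ge0}x^n\sum_{w\in[k]^n}q^{\mathrm{vis}(w)}\qquad(k\ge 1),$$ $$M_k(x,q)=\sum_{n\ge0}x^n\sum_{w\in[k-1]^n}q^{\mu_k(w)}\qquad(k\ge1),$$ where $\mu_k(w)$ is the number of visible pairs in the word $kwk$ whose pair of letters is not $(k,k)$ (so that only the pair formed by the two outer letters $k$ is left out). **Theorem.** For $j\ge1$ the series $1-xqM_j(x,q)$ is invertible in $\mathbb Z[q][[x]]$, and for every $k\ge1$ $$F_k(x,q)=1+x\sum_{j=1}^{k}\frac{1-xqM_j(x,q)}{\prod_{i=1}^{j}\bigl(1-xqM_i(x,q)\bigr)^2}.$$ Moreover $M_1(x,q)=1$, and for all $k\ge2$ $$M_k(x,q)=M_{k-1}(x,q)+\frac{xq^2M_{k-1}(x,q)^2}{1-xqM_{k-1}(x,q)}.$$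 -/

import Mathlib

open scoped Polynomial PowerSeries

/-- The set `[k]^n` of words of length `n` over the alphabet `[k] = {1, …, k}`. -/
def words (k n : ℕ) : Finset (List ℕ) :=
  (Fintype.piFinset fun _ : Fin n => Finset.Icc 1 k).image List.ofFn

theorem mem_words {k n : ℕ} {w : List ℕ} :
    w ∈ words k n ↔ w.length = n ∧ ∀ a ∈ w, 1 ≤ a ∧ a ≤ k := by
  simp only [words, Finset.mem_image, Fintype.mem_piFinset, Finset.mem_Icc]
  constructor
  · rintro ⟨f, hf, rfl⟩
    refine ⟨List.length_ofFn, fun a ha => ?_⟩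
    obtain ⟨i, rfl⟩ := (List.mem_ofFn' f a).1 ha
    exact hf i
  · rintro ⟨rfl, h⟩
    exact ⟨w.get, fun i => h _ (List.get_mem w i), List.ofFn_get w⟩

/-- The visible pairs of a word `w`: the pairs of positions `i < j` (counted from `0`) such that
every letter strictly between them is smaller than both `w_i` and `w_j`. The default value of
`getD` is never used, since all positions involved are smaller than `w.length`. -/
def visiblePairs (w : List ℕ) : Finset (ℕ × ℕ) :=
  (Finset.range w.length ×ˢ Finset.range w.length).filter fun p =>
    p.1 < p.2 ∧ ∀ m ∈ Finset.Ioo p.1 p.2, w.getD m 0 < min (w.getD p.1 0) (w.getD p.2 0)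

/-- The number `vis(w)` of visible pairs of `w`. -/
def vis (w : List ℕ) : ℕ := (visiblePairs w).card

/-- The number of visible pairs of the word `kwk` whose pair of letters is not `(k, k)`. -/
def visSandwich (k : ℕ) (w : List ℕ) : ℕ :=
  ((visiblePairs (k :: (w ++ [k]))).filter fun p =>
    ((k :: (w ++ [k])).getD p.1 0, (k :: (w ++ [k])).getD p.2 0) ≠ (k, k)).card

noncomputable section

/-- The variable `x`; the generating functions live in `ℤ[q]⟦x⟧`. -/
def xvar : ℤ[X]⟦X⟧ := PowerSeries.X

/-- The variable `q`, as an element of `ℤ[q]⟦x⟧`. -/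
def qvar : ℤ[X]⟦X⟧ := PowerSeries.C (Polynomial.X : ℤ[X])

/-- `F_k(x,q) = ∑_{n ≥ 0} x^n ∑_{w ∈ [k]^n} q^{vis(w)}`. -/
def genF (k : ℕ) : ℤ[X]⟦X⟧ :=
  PowerSeries.mk fun n => ∑ w ∈ words k n, (Polynomial.X : ℤ[X]) ^ vis w

/-- `M_k(x,q)`, for `k ≥ 1`: the generating function of the words `w ∈ [k-1]^n` by the number of
visible pairs in `kwk` other than the pair `(k, k)`. -/
def genM (k : ℕ) : ℤ[X]⟦X⟧ :=
  PowerSeries.mk fun n => ∑ w ∈ words (k - 1) n, (Polynomial.X : ℤ[X]) ^ visSandwich k w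

end

/-! ### Visible pairs -/

/-! No pair sees over a maximal letter `c`, so cutting a word there makes the visible pairs
additive, `c` being kept at the end of one factor and the start of the other (`vis_append_cons`).
Cutting at the first `k + 1` is a unique decomposition of the words over `[k + 1]` containing that
letter, and gives linear equations between generating functions (`wordGF_succ`).

A word over `[k]` enclosed by two larger letters contributes `q * M_{k+1}`, the extra `q` counting
the outer pair. Hence bounding words over `[k]` by `k + 1` on one side, left or right, gives series
`A_k` and `B_k`, each equal to the inverse of `∏ i ≤ k, (1 - x q M_i)`. Then `F_{k+1} - F_k = x *
A_k * B_{k+1}` yields the formula by telescoping.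

For `M`, the only visible pair passing over the largest inner letter is the outer one, which
`visSandwich` leaves out, so the same cut applies (`visSandwich_append_cons`). -/

theorem mem_visiblePairs {w : List ℕ} {p : ℕ × ℕ} :
    p ∈ visiblePairs w ↔ p.1 < p.2 ∧ p.2 < w.length ∧ ∀ m, p.1 < m → m < p.2 →
      w.getD m 0 < w.getD p.1 0 ∧ w.getD m 0 < w.getD p.2 0 := by
  simp only [visiblePairs, Finset.mem_filter, Finset.mem_product, Finset.mem_range,
    Finset.mem_Ioo, lt_min_iff, and_imp]
  constructor
  · rintro ⟨⟨-, h2⟩, h, hm⟩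
    exact ⟨h, h2, hm⟩
  · rintro ⟨h, h2, hm⟩
    exact ⟨⟨h.trans h2, h2⟩, h, hm⟩

theorem visiblePairs_filter_snd_le (u : List ℕ) (c : ℕ) (v : List ℕ) :
    (visiblePairs (u ++ c :: v)).filter (fun p => p.2 ≤ u.length) = visiblePairs (u ++ [c]) := by
  have key : ∀ m ≤ u.length, (u ++ c :: v).getD m 0 = (u ++ [c]).getD m 0 := by
    intro m hm
    rcases hm.lt_or_eq with h | rfl
    · rw [List.getD_append _ _ _ _ h, List.getD_append _ _ _ _ h]
    · rw [List.getD_append_right _ _ _ _ le_rfl, List.getD_append_right _ _ _ _ le_rfl]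
      simp
  ext p
  simp only [Finset.mem_filter, mem_visiblePairs, List.length_append, List.length_cons,
    List.length_nil]
  constructor
  · rintro ⟨⟨h1, h2, h3⟩, h4⟩
    refine ⟨h1, by omega, fun m hm hm' => ?_⟩
    rw [← key m (by omega), ← key p.1 (by omega), ← key p.2 (by omega)]
    exact h3 m hm hm'
  · rintro ⟨h1, h2, h3⟩
    refine ⟨⟨h1, by omega, fun m hm hm' => ?_⟩, by omega⟩
    rw [key m (by omega), key p.1 (by omega), key p.2 (by omega)]
    exact h3 m hm hm'

theorem card_visiblePairs_filter_le_fst (u v : List ℕ) :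
    ((visiblePairs (u ++ v)).filter (fun p => u.length ≤ p.1)).card = vis v := by
  have key : ∀ m, (u ++ v).getD (u.length + m) 0 = v.getD m 0 := by
    intro m
    rw [List.getD_append_right _ _ _ _ (by omega)]
    simp
  symm
  refine Finset.card_nbij (fun p => (u.length + p.1, u.length + p.2)) ?_ ?_ ?_
  · intro p hp
    obtain ⟨h1, h2, h3⟩ := mem_visiblePairs.1 hp
    refine Finset.mem_filter.2 ⟨mem_visiblePairs.2 ⟨by simpa, by simpa, fun m hm hm' => ?_⟩, by simp⟩
    obtain ⟨m, rfl⟩ := Nat.exists_eq_add_of_le (show u.length ≤ m by dsimp only at hm; omega)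
    simp only [key]
    exact h3 m (by simpa using hm) (by simpa using hm')
  · rintro ⟨a, b⟩ - ⟨a', b'⟩ - h
    simpa using h
  · rintro ⟨a, b⟩ hp
    obtain ⟨hp, h⟩ := Finset.mem_filter.1 hp
    obtain ⟨h1, h2, h3⟩ := mem_visiblePairs.1 hp
    dsimp only at h h1 h2 h3
    obtain ⟨a, rfl⟩ := Nat.exists_eq_add_of_le h
    obtain ⟨b, rfl⟩ := Nat.exists_eq_add_of_le (show u.length ≤ b by omega)
    refine ⟨(a, b), mem_visiblePairs.2 ⟨by simpa using h1, by simpa using h2, fun m hm hm' => ?_⟩,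
      rfl⟩
    have := h3 (u.length + m) (by simpa using hm) (by simpa using hm')
    simpa only [key] using this

/-- The visible pairs not passing over a given letter `c` are those of the two factors that
`c` delimits. -/
theorem card_visiblePairs_filter_not_across (u : List ℕ) (c : ℕ) (v : List ℕ) :
    ((visiblePairs (u ++ c :: v)).filter (fun p => ¬ (p.1 < u.length ∧ u.length < p.2))).card =
      vis (u ++ [c]) + vis (c :: v) := by
  rw [← card_visiblePairs_filter_le_fst u (c :: v), vis, ← visiblePairs_filter_snd_le u c v,
    ← Finset.card_union_of_disjoint, ← Finset.filter_or]
  · congr 1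
    refine Finset.filter_congr fun p _ => ?_
    omega
  · refine Finset.disjoint_filter.2 fun p hp h => ?_
    have := (mem_visiblePairs.1 hp).1
    omega

/-- A visible pair passing over `c` needs a letter greater than `c` on each side, so a bound on one
side suffices. -/
theorem vis_append_cons {u : List ℕ} {c : ℕ} {v : List ℕ}
    (h : (∀ a ∈ u, a ≤ c) ∨ ∀ a ∈ v, a ≤ c) :
    vis (u ++ c :: v) = vis (u ++ [c]) + vis (c :: v) := by
  rw [← card_visiblePairs_filter_not_across, Finset.filter_true_of_mem, vis]
  rintro ⟨i, j⟩ hp ⟨h1, h2⟩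
  obtain ⟨-, h4, h5⟩ := mem_visiblePairs.1 hp
  obtain ⟨h5, h6⟩ := h5 _ h1 h2
  dsimp only at h1 h2 h4 h5 h6
  have hc : (u ++ c :: v).getD u.length 0 = c := by
    rw [List.getD_append_right _ _ _ _ le_rfl]; simp
  rw [hc] at h5 h6
  rcases h with h | h
  · rw [List.getD_append _ _ _ _ h1, List.getD_eq_getElem _ _ h1] at h5
    exact absurd (h _ (List.getElem_mem h1)) (by omega)
  · obtain ⟨j, rfl⟩ := Nat.exists_eq_add_of_le (Nat.succ_le_of_lt h2)
    have hj : j < v.length := by simp at h4; omega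
    rw [List.getD_append_right _ _ _ _ (by omega),
      show u.length.succ + j - u.length = j + 1 by omega, List.getD_cons_succ,
      List.getD_eq_getElem _ _ hj] at h6
    exact absurd (h _ (List.getElem_mem hj)) (by omega)

/-- Replacing a first letter larger than all others by another such letter does not change the
number of visible pairs. -/
theorem vis_cons_congr {a b : ℕ} {w : List ℕ} (ha : ∀ x ∈ w, x < a) (hb : ∀ x ∈ w, x < b) :
    vis (a :: w) = vis (b :: w) := by
  have key : ∀ {a b : ℕ}, (∀ x ∈ w, x < b) →
      visiblePairs (a :: w) ⊆ visiblePairs (b :: w) := by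
    rintro a b hb ⟨i, j⟩ hp
    obtain ⟨h1, h2, h3⟩ := mem_visiblePairs.1 hp
    refine mem_visiblePairs.2 ⟨h1, h2, fun m hm hm' => ?_⟩
    have := h3 m hm hm'
    dsimp only at *
    obtain ⟨m, rfl⟩ := Nat.exists_eq_succ_of_ne_zero (show m ≠ 0 by omega)
    obtain ⟨j, rfl⟩ := Nat.exists_eq_succ_of_ne_zero (show j ≠ 0 by omega)
    cases i with
    | zero =>
      simp only [Nat.succ_eq_add_one, List.getD_cons_succ, List.getD_cons_zero] at this ⊢
      have hm : m < w.length := by simp at h2; omega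
      refine ⟨?_, this.2⟩
      rw [List.getD_eq_getElem _ _ hm]
      exact hb _ (List.getElem_mem hm)
    | succ i => simpa only [Nat.succ_eq_add_one, List.getD_cons_succ] using this
  exact congrArg Finset.card (Finset.Subset.antisymm (key hb) (key ha))

/-- Replacing a last letter larger than all others by another such letter does not change the
number of visible pairs. -/
theorem vis_append_singleton_congr {a b : ℕ} {w : List ℕ} (ha : ∀ x ∈ w, x < a)
    (hb : ∀ x ∈ w, x < b) : vis (w ++ [a]) = vis (w ++ [b]) := by
  have key : ∀ {a b : ℕ}, (∀ x ∈ w, x < b) →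
      visiblePairs (w ++ [a]) ⊆ visiblePairs (w ++ [b]) := by
    rintro a b hb ⟨i, j⟩ hp
    obtain ⟨h1, h2, h3⟩ := mem_visiblePairs.1 hp
    refine mem_visiblePairs.2 ⟨h1, by simpa using h2, fun m hm hm' => ?_⟩
    have := h3 m hm hm'
    simp only [List.length_append, List.length_singleton] at *
    have hm0 : m < w.length := by omega
    rw [List.getD_append _ _ _ m hm0, List.getD_append _ _ _ i (by omega)] at this ⊢
    refine ⟨this.1, ?_⟩
    rcases (show j ≤ w.length by omega).lt_or_eq with hj | rfl
    · rw [List.getD_append _ _ _ _ hj] at this ⊢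
      exact this.2
    · rw [List.getD_append_right _ _ _ _ le_rfl, List.getD_eq_getElem _ _ hm0]
      simpa using hb _ (List.getElem_mem hm0)
  exact congrArg Finset.card (Finset.Subset.antisymm (key hb) (key ha))

/-! ### Words enclosed by two larger letters -/

theorem getD_sandwich {a b i : ℕ} {w : List ℕ} (hi : i < w.length) :
    (a :: (w ++ [b])).getD (i + 1) 0 = w[i] := by
  rw [List.getD_cons_succ, List.getD_append _ _ _ _ hi, List.getD_eq_getElem _ _ hi]

theorem getD_sandwich_last {a b : ℕ} {w : List ℕ} :
    (a :: (w ++ [b])).getD (w.length + 1) 0 = b := by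
  rw [List.getD_cons_succ, List.getD_append_right _ _ _ _ le_rfl]
  simp

/-- Enlarging an outer letter beyond all of `w` cannot block a view, so only the new letters need a
bound; two such inclusions give equality. -/
theorem visiblePairs_sandwich_subset {a b a' b' : ℕ} {w : List ℕ}
    (ha : ∀ x ∈ w, x < a') (hb : ∀ x ∈ w, x < b') :
    visiblePairs (a :: (w ++ [b])) ⊆ visiblePairs (a' :: (w ++ [b'])) := by
  rintro ⟨i, j⟩ hp
  obtain ⟨h1, h2, h3⟩ := mem_visiblePairs.1 hp
  simp only [List.length_cons, List.length_append, List.length_nil] at h1 h2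
  refine mem_visiblePairs.2 ⟨h1, by simpa using h2, fun m hm hm' => ?_⟩
  have := h3 m hm hm'
  dsimp only at *
  obtain ⟨m, rfl⟩ := Nat.exists_eq_succ_of_ne_zero (show m ≠ 0 by omega)
  obtain ⟨j, rfl⟩ := Nat.exists_eq_succ_of_ne_zero (show j ≠ 0 by omega)
  have hm0 : m < w.length := by omega
  have hmem := List.getElem_mem hm0
  simp only [Nat.succ_eq_add_one] at *
  rw [getD_sandwich hm0] at this ⊢
  refine ⟨?_, ?_⟩
  · cases i with
    | zero => simpa using ha _ hmem
    | succ i =>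
      have hi : i < w.length := by omega
      rw [getD_sandwich hi] at this ⊢
      exact this.1
  · rcases (show j ≤ w.length by omega).lt_or_eq with hj | rfl
    · rw [getD_sandwich hj] at this ⊢
      exact this.2
    · rw [getD_sandwich_last]
      exact hb _ hmem

theorem vis_sandwich_congr {a b a' b' : ℕ} {w : List ℕ} (ha : ∀ x ∈ w, x < a)
    (hb : ∀ x ∈ w, x < b) (ha' : ∀ x ∈ w, x < a') (hb' : ∀ x ∈ w, x < b') :
    vis (a :: (w ++ [b])) = vis (a' :: (w ++ [b'])) :=
  congrArg Finset.card (Finset.Subset.antisymm (visiblePairs_sandwich_subset ha' hb')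
    (visiblePairs_sandwich_subset ha hb))

/-- This turns the condition on letters in `visSandwich` into the removal of one pair of positions.
-/
theorem sandwich_letters_eq_iff {k : ℕ} {w : List ℕ} (hw : ∀ x ∈ w, x < k) {p : ℕ × ℕ}
    (hp : p ∈ visiblePairs (k :: (w ++ [k]))) :
    ((k :: (w ++ [k])).getD p.1 0, (k :: (w ++ [k])).getD p.2 0) = (k, k) ↔
      p = (0, w.length + 1) := by
  obtain ⟨i, j⟩ := p
  obtain ⟨h1, h2, -⟩ := mem_visiblePairs.1 hp
  simp only [List.length_cons, List.length_append, List.length_nil] at h1 h2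
  simp only [Prod.mk.injEq]
  constructor
  · rintro ⟨hi, hj⟩
    constructor
    · cases i with
      | zero => rfl
      | succ i =>
        have hi' : i < w.length := by omega
        rw [getD_sandwich hi'] at hi
        exact absurd (hw _ (List.getElem_mem hi')) (by omega)
    · obtain ⟨j, rfl⟩ := Nat.exists_eq_succ_of_ne_zero (show j ≠ 0 by omega)
      by_contra hne
      have hj' : j < w.length := by omega
      rw [Nat.succ_eq_add_one, getD_sandwich hj'] at hj
      exact absurd (hw _ (List.getElem_mem hj')) (by omega)
  · rintro ⟨rfl, rfl⟩
    exact ⟨List.getD_cons_zero, getD_sandwich_last⟩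

theorem mem_visiblePairs_sandwich {k : ℕ} {w : List ℕ} (hw : ∀ x ∈ w, x < k) :
    (0, w.length + 1) ∈ visiblePairs (k :: (w ++ [k])) := by
  refine mem_visiblePairs.2 ⟨by simp, by simp, fun m hm hm' => ?_⟩
  obtain ⟨m, rfl⟩ := Nat.exists_eq_succ_of_ne_zero (show m ≠ 0 by dsimp only at hm; omega)
  have hm0 : m < w.length := by dsimp only at hm'; omega
  rw [Nat.succ_eq_add_one, getD_sandwich hm0, getD_sandwich_last, List.getD_cons_zero]
  exact ⟨hw _ (List.getElem_mem hm0), hw _ (List.getElem_mem hm0)⟩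

theorem vis_sandwich_self {k : ℕ} {w : List ℕ} (hw : ∀ x ∈ w, x < k) :
    vis (k :: (w ++ [k])) = visSandwich k w + 1 := by
  have : visSandwich k w = ((visiblePairs (k :: (w ++ [k]))).erase (0, w.length + 1)).card := by
    rw [visSandwich, ← Finset.filter_ne']
    congr 1
    exact Finset.filter_congr fun p hp => not_congr (sandwich_letters_eq_iff hw hp)
  rw [this, Finset.card_erase_add_one (mem_visiblePairs_sandwich hw), vis]

theorem vis_sandwich {k a b : ℕ} {w : List ℕ} (hw : ∀ x ∈ w, x < k) (ha : ∀ x ∈ w, x < a)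
    (hb : ∀ x ∈ w, x < b) : vis (a :: (w ++ [b])) = visSandwich k w + 1 := by
  rw [vis_sandwich_congr ha hb hw hw, vis_sandwich_self hw]

theorem visSandwich_congr {k l : ℕ} {w : List ℕ} (hk : ∀ x ∈ w, x < k) (hl : ∀ x ∈ w, x < l) :
    visSandwich k w = visSandwich l w := by
  have := vis_sandwich_self hk
  rw [vis_sandwich hl hk hk] at this
  omega

/-- A visible pair passing over `c` has both letters above `c`, so it is the outer pair: leaving
that pair out is the same as forbidding passage over `c`. -/
theorem visSandwich_append_cons {k c : ℕ} {u v : List ℕ} (hc : c < k) (hu : ∀ x ∈ u, x ≤ c)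
    (hv : ∀ x ∈ v, x ≤ c) :
    visSandwich k (u ++ c :: v) = vis (k :: (u ++ [c])) + vis (c :: (v ++ [k])) := by
  have hw : ∀ x ∈ u ++ c :: v, x < k := by
    intro x hx
    rcases List.mem_append.1 hx with h | h
    · exact (hu x h).trans_lt hc
    · rcases List.mem_cons.1 h with rfl | h
      · exact hc
      · exact (hv x h).trans_lt hc
  have hl : k :: ((u ++ c :: v) ++ [k]) = (k :: u) ++ c :: (v ++ [k]) := by simp
  have hr : k :: (u ++ [c]) = (k :: u) ++ [c] := by simp
  rw [hr, ← card_visiblePairs_filter_not_across, visSandwich, ← hl]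
  congr 1
  refine Finset.filter_congr fun p hp => not_congr ?_
  rw [sandwich_letters_eq_iff hw hp]
  constructor
  · rintro rfl
    simp
  · rintro ⟨h1, h2⟩
    obtain ⟨i, j⟩ := p
    obtain ⟨-, h4, h5⟩ := mem_visiblePairs.1 hp
    obtain ⟨h5, h6⟩ := h5 _ h1 h2
    simp only [List.length_cons, List.length_append, List.length_nil] at h1 h2 h4 h5 h6
    rw [show (k :: (u ++ c :: v ++ [k])).getD (u.length + 1) 0 = c by
      rw [getD_sandwich (by simp)]; simp] at h5 h6
    have hle : ∀ x ∈ u ++ c :: v, x ≤ c := by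
      intro x hx
      rcases List.mem_append.1 hx with h | h
      · exact hu x h
      · rcases List.mem_cons.1 h with rfl | h
        · exact le_rfl
        · exact hv x h
    refine Prod.ext ?_ ?_
    · cases i with
      | zero => rfl
      | succ i =>
        have hi : i < (u ++ c :: v).length := by simp; omega
        rw [getD_sandwich hi] at h5
        exact absurd (hle _ (List.getElem_mem hi)) (by omega)
    · obtain ⟨j, rfl⟩ := Nat.exists_eq_succ_of_ne_zero (show j ≠ 0 by omega)
      by_contra hne
      have hj : j < (u ++ c :: v).length := by simp at hne ⊢; omega
      rw [Nat.succ_eq_add_one, getD_sandwich hj] at h6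
      exact absurd (hle _ (List.getElem_mem hj)) (by omega)

/-! ### Generating functions of words -/

noncomputable section

/-- The generating function of the words over `[k]` by a statistic `s`. -/
def wordGF (k : ℕ) (s : List ℕ → ℕ) : ℤ[X]⟦X⟧ :=
  PowerSeries.mk fun n => ∑ w ∈ words k n, (Polynomial.X : ℤ[X]) ^ s w

end

theorem wordGF_congr {k : ℕ} {s t : List ℕ → ℕ} (h : ∀ w, (∀ x ∈ w, x ≤ k) → s w = t w) :
    wordGF k s = wordGF k t := by
  ext1 n
  simp only [wordGF, PowerSeries.coeff_mk]
  refine Finset.sum_congr rfl fun w hw => ?_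
  rw [h w fun x hx => ((mem_words.1 hw).2 x hx).2]

theorem wordGF_add_one (k : ℕ) (s : List ℕ → ℕ) :
    wordGF k (fun w => s w + 1) = qvar * wordGF k s := by
  ext1 n
  simp only [wordGF, qvar, PowerSeries.coeff_C_mul, PowerSeries.coeff_mk, Finset.mul_sum, pow_succ']

theorem words_zero_right (k : ℕ) : words k 0 = {[]} := by
  ext w
  rw [mem_words, Finset.mem_singleton, List.length_eq_zero_iff]
  exact ⟨fun h => h.1, by rintro rfl; simp⟩

theorem wordGF_zero {s : List ℕ → ℕ} (h : s [] = 0) : wordGF 0 s = 1 := by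
  ext1 n
  rw [wordGF, PowerSeries.coeff_mk, PowerSeries.coeff_one]
  split_ifs with hn
  · rw [hn, words_zero_right, Finset.sum_singleton, h, pow_zero]
  · refine Finset.sum_eq_zero fun w hw => absurd ?_ hn
    obtain ⟨h1, h2⟩ := mem_words.1 hw
    rw [← h1, List.length_eq_zero_iff]
    exact List.eq_nil_iff_forall_not_mem.2 fun x hx => by have := h2 x hx; omega

theorem append_cons_inj_of_forall_le {k : ℕ} {u u' v v' : List ℕ} (hu : ∀ x ∈ u, x ≤ k)
    (hu' : ∀ x ∈ u', x ≤ k) (h : u ++ (k + 1) :: v = u' ++ (k + 1) :: v') : u = u' ∧ v = v' := by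
  induction u generalizing u' with
  | nil =>
    cases u' with
    | nil => simpa using h
    | cons a u' =>
      have := hu' a (by simp)
      simp at h
      omega
  | cons b u ih =>
    cases u' with
    | nil =>
      have := hu b (by simp)
      simp at h
      omega
    | cons a u' =>
      simp only [List.cons_append, List.cons.injEq] at h
      obtain ⟨h1, h2⟩ := ih (fun x hx => hu x (by simp [hx])) (fun x hx => hu' x (by simp [hx])) h.2
      exact ⟨by rw [h.1, h1], h2⟩

/-- Decomposition of the words over `[k + 1]` at the first occurrence of the letter `k + 1`. -/
theorem wordGF_succ {k : ℕ} {s g h : List ℕ → ℕ}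
    (hs : ∀ u v : List ℕ, (∀ x ∈ u, x ≤ k) → (∀ x ∈ v, x ≤ k + 1) →
      s (u ++ (k + 1) :: v) = g u + h v) :
    wordGF (k + 1) s = wordGF k s + xvar * (wordGF k g * wordGF (k + 1) h) := by
  ext1 n
  cases n with
  | zero => simp [wordGF, xvar, words_zero_right]
  | succ n =>
    rw [map_add, xvar, PowerSeries.coeff_succ_X_mul, PowerSeries.coeff_mul]
    simp only [wordGF, PowerSeries.coeff_mk]
    rw [← Finset.sum_filter_not_add_sum_filter (words (k + 1) (n + 1)) (fun w => k + 1 ∈ w)]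
    congr 1
    · refine Finset.sum_congr (Finset.ext fun w => ?_) fun _ _ => rfl
      simp only [Finset.mem_filter, mem_words]
      constructor
      · rintro ⟨⟨h1, h2⟩, h3⟩
        refine ⟨h1, fun x hx => ⟨(h2 x hx).1, ?_⟩⟩
        have := (h2 x hx).2
        have : x ≠ k + 1 := by rintro rfl; exact h3 hx
        omega
      · rintro ⟨h1, h2⟩
        refine ⟨⟨h1, fun x hx => ⟨(h2 x hx).1, (h2 x hx).2.trans (Nat.le_succ k)⟩⟩, fun h3 => ?_⟩
        have := (h2 _ h3).2
        omega
    · simp only [Finset.sum_mul_sum, ← Finset.sum_product']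
      rw [Finset.sum_sigma']
      symm
      refine Finset.sum_bij (fun p _ => p.2.1 ++ (k + 1) :: p.2.2) ?_ ?_ ?_ ?_
      · rintro ⟨⟨a, b⟩, u, v⟩ hp
        simp only [Finset.mem_sigma, Finset.mem_product,
          Finset.HasAntidiagonal.mem_antidiagonal, mem_words] at hp
        obtain ⟨hab, ⟨hu, hu'⟩, hv, hv'⟩ := hp
        simp only [Finset.mem_filter, mem_words, List.length_append, List.length_cons,
          List.mem_append, List.mem_cons]
        refine ⟨⟨by omega, ?_⟩, by simp⟩
        rintro x (hx | rfl | hx)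
        · have := hu' x hx
          omega
        · omega
        · exact hv' x hx
      · rintro ⟨⟨a, b⟩, u, v⟩ hp ⟨⟨a', b'⟩, u', v'⟩ hp' heq
        simp only [Finset.mem_sigma, Finset.mem_product,
          Finset.HasAntidiagonal.mem_antidiagonal, mem_words] at hp hp'
        obtain ⟨-, ⟨rfl, hu⟩, rfl, -⟩ := hp
        obtain ⟨-, ⟨rfl, hu'⟩, rfl, -⟩ := hp'
        obtain ⟨rfl, rfl⟩ := append_cons_inj_of_forall_le (fun x hx => (hu x hx).2)
          (fun x hx => (hu' x hx).2) heq
        rfl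
      · intro w hw
        simp only [Finset.mem_filter, mem_words] at hw
        obtain ⟨⟨h1, h2⟩, h3⟩ := hw
        -- Here `u` avoids `k + 1`: the cut is at the first occurrence.
        obtain ⟨u, v, rfl, hu⟩ := List.eq_append_cons_of_mem h3
        simp only [List.length_append, List.length_cons] at h1
        refine ⟨⟨(u.length, v.length), u, v⟩, ?_, rfl⟩
        simp only [Finset.mem_sigma, Finset.mem_product,
          Finset.HasAntidiagonal.mem_antidiagonal, mem_words]
        refine ⟨by omega, ⟨trivial, fun x hx => ?_⟩, trivial, fun x hx => h2 x (by simp [hx])⟩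
        have := h2 x (by simp [hx])
        have : x ≠ k + 1 := by rintro rfl; exact hu hx
        omega
      · rintro ⟨⟨a, b⟩, u, v⟩ hp
        simp only [Finset.mem_sigma, Finset.mem_product, mem_words] at hp
        dsimp only
        rw [hs u v (fun x hx => (hp.2.1.2 x hx).2) (fun x hx => (hp.2.2.2 x hx).2), pow_add]

/-! ### The functional equations -/

theorem genM_succ (k : ℕ) : genM (k + 1) = wordGF k (visSandwich (k + 1)) := rfl

theorem wordGF_vis_sandwich {k a b : ℕ} (ha : k < a) (hb : k < b) :
    wordGF k (fun w => vis (a :: (w ++ [b]))) = qvar * genM (k + 1) := by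
  rw [genM_succ, ← wordGF_add_one]
  exact wordGF_congr fun w hw => vis_sandwich (fun x hx => Nat.lt_succ_of_le (hw x hx))
    (fun x hx => (hw x hx).trans_lt ha) (fun x hx => (hw x hx).trans_lt hb)

/-- A renewal equation: after the cut at the first `k + 1`, the right factor is again enclosed by `k
+ 1` and `k + 2`. -/
theorem wordGF_vis_cons_append (k : ℕ) :
    (1 - xvar * qvar * genM (k + 1)) *
      wordGF (k + 1) (fun w => vis ((k + 1) :: (w ++ [k + 2]))) = qvar * genM (k + 1) := by
  have h := wordGF_succ (k := k) (s := fun w => vis ((k + 1) :: (w ++ [k + 2])))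
    (g := fun u => vis ((k + 1) :: (u ++ [k + 1]))) (h := fun v => vis ((k + 1) :: (v ++ [k + 2])))
    (fun u v hu hv => by
      have := vis_append_cons (u := (k + 1) :: u) (c := k + 1) (v := v ++ [k + 2]) (Or.inl ?_)
      · simpa using this
      · simp only [List.mem_cons, forall_eq_or_imp]
        exact ⟨le_rfl, fun x hx => (hu x hx).trans (Nat.le_succ k)⟩)
  rw [wordGF_vis_sandwich (k := k) (b := k + 2) (by omega) (by omega),
    wordGF_vis_sandwich (k := k) (b := k + 1) (by omega) (by omega)] at h
  linear_combination h

theorem genM_add_two (k : ℕ) :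
    genM (k + 2) = genM (k + 1) + xvar * (qvar * genM (k + 1) *
      wordGF (k + 1) (fun w => vis ((k + 1) :: (w ++ [k + 2])))) := by
  rw [genM_succ (k + 1), wordGF_succ (g := fun u => vis ((k + 2) :: (u ++ [k + 1])))
    (h := fun v => vis ((k + 1) :: (v ++ [k + 2])))
    (fun u v hu hv => visSandwich_append_cons (Nat.lt_succ_self _)
      (fun x hx => (hu x hx).trans (Nat.le_succ k)) hv),
    wordGF_vis_sandwich (by omega) (by omega), genM_succ k]
  congr 1
  exact wordGF_congr fun w hw => visSandwich_congr
    (fun x hx => (hw x hx).trans_lt (by omega)) (fun x hx => (hw x hx).trans_lt (by omega))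

/-- The right side does not involve `a`: taking `a = k + 1` gives a recursion, and comparing with `a
= k + 2` lets it be iterated in `k`. -/
theorem wordGF_vis_cons_split {k a : ℕ} (ha : k < a) :
    wordGF (k + 1) (fun w => vis (a :: w)) = wordGF k (fun w => vis ((k + 1) :: w)) +
      xvar * (qvar * genM (k + 1) * wordGF (k + 1) (fun w => vis ((k + 1) :: w))) := by
  rw [wordGF_succ (g := fun u => vis (a :: (u ++ [k + 1]))) (h := fun v => vis ((k + 1) :: v))
    (fun u v hu hv => by
      simpa using vis_append_cons (u := a :: u) (c := k + 1) (v := v) (Or.inr hv)),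
    wordGF_vis_sandwich ha (by omega)]
  congr 1
  exact wordGF_congr fun w hw => vis_cons_congr
    (fun x hx => (hw x hx).trans_lt ha) (fun x hx => (hw x hx).trans_lt (by omega))

theorem wordGF_vis_cons_self (k : ℕ) :
    (1 - xvar * qvar * genM (k + 1)) * wordGF (k + 1) (fun w => vis ((k + 1) :: w)) =
      wordGF k (fun w => vis ((k + 1) :: w)) := by
  linear_combination wordGF_vis_cons_split (Nat.lt_succ_self k)

theorem wordGF_vis_cons_add_two (k : ℕ) :
    wordGF (k + 1) (fun w => vis ((k + 2) :: w)) =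
      wordGF (k + 1) (fun w => vis ((k + 1) :: w)) := by
  rw [wordGF_vis_cons_split (show k < k + 2 by omega), ← wordGF_vis_cons_split (Nat.lt_succ_self k)]

theorem wordGF_vis_append_succ (k : ℕ) :
    (1 - xvar * qvar * genM (k + 1)) * wordGF (k + 1) (fun w => vis (w ++ [k + 2])) =
      wordGF k (fun w => vis (w ++ [k + 1])) := by
  have h := wordGF_succ (k := k) (s := fun w => vis (w ++ [k + 2]))
    (g := fun u => vis (u ++ [k + 1])) (h := fun v => vis ((k + 1) :: (v ++ [k + 2])))
    (fun u v hu hv => by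
      simpa using vis_append_cons (u := u) (c := k + 1) (v := v ++ [k + 2])
        (Or.inl fun x hx => (hu x hx).trans (Nat.le_succ k)))
  have h' : wordGF k (fun w => vis (w ++ [k + 2])) = wordGF k (fun w => vis (w ++ [k + 1])) :=
    wordGF_congr fun w hw => vis_append_singleton_congr
      (fun x hx => (hw x hx).trans_lt (by omega)) (fun x hx => (hw x hx).trans_lt (by omega))
  rw [h'] at h
  -- Multiplying by `1 - x q M_{k+1}` turns the renewal series in `h` into `q * M_{k+1}`, and the
  -- terms in `M_{k+1}` cancel.
  linear_combination (1 - xvar * qvar * genM (k + 1)) * h +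
    xvar * wordGF k (fun w => vis (w ++ [k + 1])) * wordGF_vis_cons_append k

theorem genF_succ (k : ℕ) :
    genF (k + 1) = genF k + xvar * (wordGF k (fun w => vis (w ++ [k + 1])) *
      wordGF (k + 1) (fun w => vis ((k + 1) :: w))) :=
  wordGF_succ fun _ _ hu _ => vis_append_cons (Or.inl fun x hx => (hu x hx).trans (Nat.le_succ k))

/-! ### Initial values, invertibility and closed forms -/

theorem vis_nil : vis [] = 0 := rfl

theorem vis_singleton (a : ℕ) : vis [a] = 0 := by
  rw [vis, Finset.card_eq_zero, Finset.eq_empty_iff_forall_notMem]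
  intro p hp
  obtain ⟨h1, h2, -⟩ := mem_visiblePairs.1 hp
  simp only [List.length_singleton] at h2
  omega

theorem genM_one : genM 1 = 1 := by
  refine wordGF_zero (s := visSandwich 1) ?_
  decide

theorem isUnit_one_sub (j : ℕ) : IsUnit (1 - xvar * qvar * genM j) := by
  rw [PowerSeries.isUnit_iff_constantCoeff]
  simp [xvar]

theorem prod_mul_wordGF_vis_append (k : ℕ) :
    (∏ i ∈ Finset.Icc 1 k, (1 - xvar * qvar * genM i)) *
      wordGF k (fun w => vis (w ++ [k + 1])) = 1 := by
  induction k with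
  | zero => simpa using wordGF_zero (vis_singleton 1)
  | succ k ih =>
    rw [Finset.prod_Icc_succ_top (by omega), mul_assoc, wordGF_vis_append_succ, ih]

theorem prod_mul_wordGF_vis_cons (k : ℕ) :
    (∏ i ∈ Finset.Icc 1 k, (1 - xvar * qvar * genM i)) *
      wordGF k (fun w => vis ((k + 1) :: w)) = 1 := by
  induction k with
  | zero => simpa using wordGF_zero (s := fun w => vis (1 :: w)) (vis_singleton 1)
  | succ k ih =>
    rw [Finset.prod_Icc_succ_top (by omega), mul_assoc, wordGF_vis_cons_add_two,
      wordGF_vis_cons_self, ih]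

theorem eq_mul_ringInverse {R : Type*} [CommRing R] {a b c : R} (hc : IsUnit c)
    (h : c * a = b) : a = b * Ring.inverse c := by
  rw [← h, mul_comm c a, mul_assoc, Ring.mul_inverse_cancel c hc, mul_one]

theorem genF_eq (k : ℕ) :
    genF k = 1 + xvar * ∑ j ∈ Finset.Icc 1 k,
      (1 - xvar * qvar * genM j) *
        Ring.inverse (∏ i ∈ Finset.Icc 1 j, (1 - xvar * qvar * genM i) ^ 2) := by
  induction k with
  | zero =>
    have h : genF 0 = 1 := wordGF_zero vis_nil
    simpa using h
  | succ k ih =>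
    rw [genF_succ, ih, Finset.sum_Icc_succ_top (by omega), mul_add, add_assoc]
    congr 3
    refine eq_mul_ringInverse ?_ ?_
    · exact IsUnit.prod_iff.2 fun i _ => (isUnit_one_sub i).pow 2
    · have hA := prod_mul_wordGF_vis_append k
      have hB := prod_mul_wordGF_vis_cons k
      have hL := wordGF_vis_cons_self k
      rw [Finset.prod_pow, Finset.prod_Icc_succ_top (by omega)]
      set P := ∏ i ∈ Finset.Icc 1 k, (1 - xvar * qvar * genM i)
      set A := wordGF k (fun w => vis (w ++ [k + 1]))
      set d := 1 - xvar * qvar * genM (k + 1)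
      -- One factor `d` survives because `A` inverts only the product up to `k`, while the word
      -- after the cut contributes the inverse of `P * d`.
      linear_combination P ^ 2 * d * A * hL + d * P * A * hB + d * hA

theorem mainTheorem4 (k : ℕ) (hk : 1 ≤ k) :
    (∀ j : ℕ, 1 ≤ j → IsUnit (1 - xvar * qvar * genM j)) ∧
    genF k = 1 + xvar * ∑ j ∈ Finset.Icc 1 k,
      (1 - xvar * qvar * genM j) *
        Ring.inverse (∏ i ∈ Finset.Icc 1 j, (1 - xvar * qvar * genM i) ^ 2) ∧
    genM 1 = 1 ∧
    ∀ j : ℕ, 2 ≤ j →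
      genM j = genM (j - 1) +
        xvar * qvar ^ 2 * genM (j - 1) ^ 2 *
          Ring.inverse (1 - xvar * qvar * genM (j - 1)) := by
  refine ⟨fun j _ => isUnit_one_sub j, genF_eq k, genM_one, fun j hj => ?_⟩
  obtain ⟨j, rfl⟩ := Nat.exists_eq_add_of_le' hj
  rw [show j + 2 - 1 = j + 1 by omega, genM_add_two,
    eq_mul_ringInverse (isUnit_one_sub (j + 1)) (wordGF_vis_cons_append j)]
  ring
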